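/- An $r$-uniform hypergraph $H$ is *semi-algebraic of complexity $(d,D,m)$* if there are an enumeration $v_1,\dots,v_N$ of its vertices, points $x_1,\dots,x_N\in\mathbb{R}^d$, polynomials $f_1,\dots,f_m:(\mathbb{R}^d)^r\to\mathbb{R}$ of degree at most $D$, and a function $\Phi:\{+,-,0\}^m\to\{\mathrm{True},\mathrm{False}\}$ such that for all $1\le i_1<\dots<i_r\le N$, the set $\{v_{i_1},\dots,v_{i_r}\}$ is an edge of $H$ if and only if $$\Phi\big(\operatorname{sign} f_1(x_{i_1},\dots,x_{i_r}),\dots,\operatorname{sign} f_m(x_{i_1},\dots,x_{i_r})\big)=\mathrm{True}.$$ It is *semi-linear* if $D=1$. **Theorem.** Let $r,m,p$ be positive integers. There exists $c=c(r,m,p)>0$ such that the following holds for every positive integer $d$ and every positive integer $N$ (where $N>p$ is assumed in the trivial case $r=1$). Let the edges of the complete $r$-uniform hypergraph on $N$ vertices be coloured with $p$ colours, every edge receiving at least one and possibly more than one colour, such that each colour class (the hypergraph of all edges that receive a given colour, on the same $N$ vertices) is semi-algebraic of complexity $(d,1,m)$; the vertex enumerations, points and polynomials may differ between the colours. Then there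 is a monochromatic clique of size at least $(\log N)^c$, that is, a set $C$ of at least $(\log N)^c$ vertices and a colour such that every $r$-element subset of $C$ receives that colour. -/

import Mathlib

namespace Hypergraph

/-- A hypergraph is `r`-uniform if each of its edges has exactly `r` vertices. -/
def IsUniform {α : Type*} (H : Hypergraph α) (r : ℕ) : Prop :=
  ∀ e ∈ H.edgeSet, e.encard = r

/-- The complete `r`-uniform hypergraph with vertex set `X`: its edges are all `r`-element subsets
of `X`. -/
def completeUniformOn {α : Type*} (X : Set α) (r : ℕ) : Hypergraph α where
  vertexSet := X
  edgeSet := {e | e ⊆ X ∧ e.encard = r}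
  subset_vertexSet_of_mem_edgeSet' := fun _ he => he.1

/-- `C` is a clique of the `r`-uniform hypergraph `H`: a set of vertices, all of whose `r`-element
subsets are edges. -/
def IsUniformClique {α : Type*} (H : Hypergraph α) (r : ℕ) (C : Set α) : Prop :=
  C ⊆ H.vertexSet ∧ ∀ e ⊆ C, e.encard = r → e ∈ H.edgeSet

/-- `H` is an `r`-uniform semi-algebraic hypergraph of complexity `(d, D, m)`: there are an
enumeration `v` of the vertices, points `pt i` of `ℝ^d` assigned to the vertices `v i`, and `m` real
polynomials of degree at most `D` in `r` points of `ℝ^d` (the variable `(a, b)` is the `b`-th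
coordinate of the `a`-th point), such that, for indices `i 0 < i 1 < ⋯ < i (r - 1)`, whether
`{v (i 0), …, v (i (r - 1))}` is an edge is a Boolean function `Φ` of the signs of the polynomials
at `(pt (i 0), …, pt (i (r - 1)))`. -/
def IsSemiAlgebraic {α : Type*} (H : Hypergraph α) (r d D m : ℕ) : Prop :=
  H.IsUniform r ∧
  ∃ (N : ℕ) (v : Fin N → α) (pt : Fin N → Fin d → ℝ)
    (f : Fin m → MvPolynomial (Fin r × Fin d) ℝ) (Φ : (Fin m → SignType) → Prop),
    Function.Injective v ∧ Set.range v = H.vertexSet ∧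
    (∀ j, (f j).totalDegree ≤ D) ∧
    ∀ i : Fin r → Fin N, StrictMono i →
      (Set.range (fun a => v (i a)) ∈ H.edgeSet ↔
        Φ (fun j => SignType.sign (MvPolynomial.eval (fun ab => pt (i ab.1) ab.2) (f j))))

/-- A colouring of the edges of `K` with `p` colours, where every edge receives at least one
colour, and possibly more than one. -/
structure EdgeMulticoloring {α : Type*} (K : Hypergraph α) (p : ℕ) where
  /-- The set of colours received by an edge. -/
  colors : K.edgeSet → Set (Fin p)
  /-- Every edge receives a colour. -/
  colors_nonempty : ∀ e, (colors e).Nonempty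

/-- The colour class of the colour `i`: the hypergraph on the vertices of `K` whose edges are the
edges of `K` that receive the colour `i` (and possibly others). -/
def EdgeMulticoloring.colorClass {α : Type*} {K : Hypergraph α} {p : ℕ}
    (χ : EdgeMulticoloring K p) (i : Fin p) : Hypergraph α where
  vertexSet := K.vertexSet
  edgeSet := {e | ∃ he : e ∈ K.edgeSet, i ∈ χ.colors ⟨e, he⟩}
  subset_vertexSet_of_mem_edgeSet' := fun _ he => K.subset_vertexSet_of_mem_edgeSet' he.1

end Hypergraph

/-! A polynomial of degree at most one in `r` points is a sum of functions of the single points.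
Edges are therefore decided by the signs of sums `∑ a, g j a (i a)`, and the dimension `d`
disappears. The core is `exists_tupleSignHom`: among `2 ^ n ^ C` indices there are `n` on which each
sum has one sign on all increasing tuples. Every colour class is then complete or empty there, so
the colour of one edge is a colour of all.

A sum has constant sign if one term always dominates. At polynomial cost each `g j a` becomes
monotone and lacunary: of two adjacent gaps one is at least `K` times the other (`exists_lacunary`).
Triples are coloured by which gap is the larger one. A monotone path with a single colour on its
consecutive triples (`exists_isMonoPath`) yields values whose distances from a centre grow or decay
geometrically (`exists_geometricAround`); this is the only exponential loss.

The sum is now a constant, the sum of the centres, plus `r` deviations. Comparisons between these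
terms are made uniform at polynomial cost (`exists_pairHom`). Two terms cannot stay within a bounded
factor of each other, since one of them varies geometrically while the other is held fixed
(`PairHom.dominates_of_lt`, `PairHom.const_dominates`). So one term outweighs the rest
(`exists_sign_sum_eq`). -/

namespace SemilinearRamsey

open Finset

/-! ### Homogeneous comparisons on pairs, at polynomial cost. -/

section Pairs

variable {ι : Type*} [LinearOrder ι]

/-- A relation that is transitive along increasing triples has a long increasing chain or a large
set without increasing related pairs. -/
theorem exists_chain_or_antichain (R : ι → ι → Prop) (t : ℕ) : ∀ (s : ℕ) (A : Finset ι),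
    (∀ u ∈ A, ∀ v ∈ A, ∀ w ∈ A, u < v → v < w → R u v → R v w → R u w) → s * t ≤ #A →
    (∃ B ⊆ A, s ≤ #B ∧ ∀ u ∈ B, ∀ v ∈ B, u < v → R u v) ∨
      ∃ B ⊆ A, t ≤ #B ∧ ∀ u ∈ B, ∀ v ∈ B, u < v → ¬ R u v := by
  classical
  intro s
  induction s with
  | zero => intro A _ _; exact Or.inl ⟨∅, by simp⟩
  | succ s ih =>
    intro A hA hcard
    -- As in Mirsky's theorem: elements without a related predecessor are pairwise unrelated, and a
    -- chain among the others extends downwards by a predecessor of its least element.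
    set A' := A.filter (fun v => ∀ u ∈ A, u < v → ¬ R u v) with hA'
    by_cases ht : t ≤ #A'
    · exact Or.inr ⟨A', filter_subset _ _, ht, fun u hu v hv huv =>
        (mem_filter.1 hv).2 u (mem_filter.1 hu).1 huv⟩
    push Not at ht
    have hsd : #(A \ A') = #A - #A' := card_sdiff_of_subset (filter_subset _ _)
    have h1 : s * t ≤ #(A \ A') := by
      rw [hsd]; have : (s + 1) * t = s * t + t := by ring
      omega
    have hsub : A \ A' ⊆ A := sdiff_subset
    rcases ih (A \ A') (fun u hu v hv w hw => hA u (hsub hu) v (hsub hv) w (hsub hw)) h1 with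
      ⟨B, hBA, hBs, hB⟩ | ⟨B, hBA, hBt, hB⟩
    · left
      rcases B.eq_empty_or_nonempty with rfl | hne
      · have hs : s = 0 := by simpa using hBs
        have : 0 < #A := by
          have : (s + 1) * t = s * t + t := by ring
          omega
        obtain ⟨a, ha⟩ := card_pos.1 this
        refine ⟨{a}, by simpa using ha, by simp [hs], ?_⟩
        intro u hu v hv huv
        simp only [mem_singleton] at hu hv
        exact absurd huv (by simp [hu, hv])
      · have hv := hBA (B.min'_mem hne)
        have hv' : ¬ (∀ u ∈ A, u < B.min' hne → ¬ R u (B.min' hne)) := fun h =>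
          (mem_sdiff.1 hv).2 (mem_filter.2 ⟨(mem_sdiff.1 hv).1, h⟩)
        push Not at hv'
        obtain ⟨u, huA, huv, hR⟩ := hv'
        have hlt : ∀ w ∈ B, u < w := fun w hw => huv.trans_le (B.min'_le w hw)
        refine ⟨insert u B, insert_subset huA (hBA.trans hsub), ?_, ?_⟩
        · rw [card_insert_of_notMem (fun h => lt_irrefl _ (hlt u h))]; omega
        · intro x hx y hy hxy
          rcases mem_insert.1 hx with rfl | hxB
          · rcases mem_insert.1 hy with rfl | hy
            · exact absurd hxy (lt_irrefl _)
            · rcases (B.min'_le y hy).eq_or_lt with h | h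
              · rw [← h]; exact hR
              · exact hA _ huA _ (hsub hv) _ (hsub (hBA hy)) huv h hR
                  (hB _ (B.min'_mem hne) _ hy h)
          · rcases mem_insert.1 hy with rfl | hy
            · exact absurd hxy (hlt x hxB).asymm
            · exact hB x hxB y hy hxy
    · exact Or.inr ⟨B, hBA.trans hsub, hBt, hB⟩

/-- The comparison of `F v` with `G w` is the same for all increasing pairs `v < w` in `B`. -/
def PairHom (F G : ι → ℝ) (B : Finset ι) : Prop :=
  (∀ v ∈ B, ∀ w ∈ B, v < w → F v < G w) ∨ (∀ v ∈ B, ∀ w ∈ B, v < w → G w ≤ F v)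

theorem PairHom.mono {F G : ι → ℝ} {A B : Finset ι} (h : PairHom F G B) (hAB : A ⊆ B) :
    PairHom F G A :=
  h.imp (fun h v hv w hw => h v (hAB hv) w (hAB hw)) (fun h v hv w hw => h v (hAB hv) w (hAB hw))

/-- `F v < G w` is transitive where `G v ≤ F v` at the middle element, and its negation is
transitive where `F v < G v`. One of these two parts contains at least `n * n` elements, because `2
* n ^ 2 ≤ n ^ 3` for `n ≥ 2`. -/
theorem exists_pairHom (F G : ι → ℝ) (n : ℕ) (A : Finset ι) (hA : n ^ 3 ≤ #A) :
    ∃ B ⊆ A, n ≤ #B ∧ PairHom F G B := by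
  classical
  rcases Nat.lt_or_ge n 2 with hn | hn
  · have hn3 : n ^ 3 = n := by interval_cases n <;> rfl
    obtain ⟨B, hBA, hB⟩ := exists_subset_card_eq (hn3 ▸ hA)
    refine ⟨B, hBA, hB.ge, Or.inl fun v hv w hw hvw => ?_⟩
    exact absurd (card_le_one.1 (by omega : #B ≤ 1) v hv w hw) hvw.ne
  have h2 : n * n + n * n ≤ #A := by nlinarith
  have hsplit := card_filter_add_card_filter_not (s := A) (fun v => G v ≤ F v)
  rcases le_or_gt (n * n) #(A.filter (fun v => G v ≤ F v)) with h | h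
  · rcases exists_chain_or_antichain (fun v w => F v < G w) n n (A.filter (fun v => G v ≤ F v))
      (fun u _ v hv w _ _ _ h1 h2 => h1.trans_le ((mem_filter.1 hv).2.trans h2.le)) h with
      ⟨B, hBA, hn, hB⟩ | ⟨B, hBA, hn, hB⟩
    · exact ⟨B, hBA.trans (filter_subset _ _), hn, Or.inl hB⟩
    · exact ⟨B, hBA.trans (filter_subset _ _), hn, Or.inr fun v hv w hw hvw =>
        not_lt.1 (hB v hv w hw hvw)⟩
  · rcases exists_chain_or_antichain (fun v w => G w ≤ F v) n n
      (A.filter (fun v => ¬ G v ≤ F v))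
      (fun u _ v hv w _ _ _ h1 h2 => h2.trans ((not_le.1 (mem_filter.1 hv).2).le.trans h1))
      (by omega) with ⟨B, hBA, hn, hB⟩ | ⟨B, hBA, hn, hB⟩
    · exact ⟨B, hBA.trans (filter_subset _ _), hn, Or.inr hB⟩
    · exact ⟨B, hBA.trans (filter_subset _ _), hn, Or.inl fun v hv w hw hvw =>
        not_le.1 (hB v hv w hw hvw)⟩

end Pairs

/-- Finitely many hereditary properties that each hold on a polynomially large subset hold
simultaneously on a polynomially large subset. -/
theorem exists_subset_forall {ι T : Type*} (P : T → Finset ι → Prop) (C : ℕ)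
    (hmono : ∀ t A B, A ⊆ B → P t B → P t A)
    (h : ∀ t (n : ℕ) A, n ^ C ≤ #A → ∃ B ⊆ A, n ≤ #B ∧ P t B) (S : Finset T) :
    ∀ (n : ℕ) (A : Finset ι), n ^ (C ^ #S) ≤ #A → ∃ B ⊆ A, n ≤ #B ∧ ∀ t ∈ S, P t B := by
  classical
  induction S using Finset.induction_on with
  | empty => intro n A hA; exact ⟨A, subset_rfl, by simpa using hA, by simp⟩
  | insert t S ht ih =>
    intro n A hA
    rw [card_insert_of_notMem ht, pow_succ, pow_mul] at hA
    obtain ⟨B, hBA, hB, hP⟩ := h t _ A hA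
    obtain ⟨B', hBB, hB', hP'⟩ := ih n B hB
    refine ⟨B', hBB.trans hBA, hB', fun t' ht' => ?_⟩
    rcases mem_insert.1 ht' with rfl | ht'
    · exact hmono _ _ _ hBB hP
    · exact hP' t' ht'

/-- The function `h` is increasing, decreasing or constant on `B`. -/
def SignHom {ι : Type*} [LinearOrder ι] (h : ι → ℝ) (B : Finset ι) : Prop :=
  ∃ σ : SignType, ∀ v ∈ B, ∀ w ∈ B, v < w → SignType.sign (h w - h v) = σ

theorem SignHom.mono {ι : Type*} [LinearOrder ι] {h : ι → ℝ} {A B : Finset ι} (hB : SignHom h B)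
    (hAB : A ⊆ B) : SignHom h A :=
  hB.imp fun _ hσ v hv w hw => hσ v (hAB hv) w (hAB hw)

theorem exists_signHom {ι : Type*} [LinearOrder ι] (h : ι → ℝ) (n : ℕ) (A : Finset ι)
    (hA : n ^ 9 ≤ #A) : ∃ B ⊆ A, n ≤ #B ∧ SignHom h B := by
  obtain ⟨B, hBA, hB, h1⟩ := exists_pairHom h h (n ^ 3) A (by rwa [← pow_mul])
  obtain ⟨B', hBB, hB', h2⟩ := exists_pairHom (-h) (-h) n B hB
  refine ⟨B', hBB.trans hBA, hB', ?_⟩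
  rcases h1.mono hBB with h1 | h1
  · exact ⟨1, fun v hv w hw hvw => sign_pos (sub_pos.2 (h1 v hv w hw hvw))⟩
  · rcases h2 with h2 | h2
    · refine ⟨-1, fun v hv w hw hvw => sign_neg (sub_neg.2 ?_)⟩
      simpa using h2 v hv w hw hvw
    · refine ⟨0, fun v hv w hw hvw => ?_⟩
      have h3 : h w ≤ h v := h1 v hv w hw hvw
      have h4 : h v ≤ h w := by simpa using h2 v hv w hw hvw
      rw [sub_eq_zero.2 (le_antisymm h3 h4), sign_zero]

/-! ### Lacunary subsets of polynomial size. -/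

section Thinning

variable {ι : Type*}

/-- Any two consecutive gaps between values of `h` on `B` differ by a factor of at least `K`. -/
def Lacunary (K : ℕ) (h : ι → ℝ) (B : Finset ι) : Prop :=
  ∀ u ∈ B, ∀ v ∈ B, ∀ w ∈ B, h u ≤ h v → h v ≤ h w →
    K * (h v - h u) ≤ h w - h v ∨ K * (h w - h v) ≤ h v - h u

theorem Lacunary.mono {K : ℕ} {h : ι → ℝ} {A B : Finset ι} (hB : Lacunary K h B) (hAB : A ⊆ B) :
    Lacunary K h A :=
  fun u hu v hv w hw => hB u (hAB hu) v (hAB hv) w (hAB hw)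

theorem Lacunary.neg {K : ℕ} {h : ι → ℝ} {B : Finset ι} (hB : Lacunary K h B) :
    Lacunary K (-h) B := by
  intro u hu v hv w hw huv hvw
  simp only [Pi.neg_apply, neg_le_neg_iff] at huv hvw ⊢
  rcases hB w hw v hv u hu hvw huv with h | h
  · right; linarith
  · left; linarith

theorem lacunary_of_card_le_one {K : ℕ} {h : ι → ℝ} {B : Finset ι} (hB : #B ≤ 1) :
    Lacunary K h B := by
  intro u hu v hv w hw _ _
  rw [card_le_one.1 hB u hu v hv, card_le_one.1 hB w hw v hv]
  simp

/-- Points far to the right of an interval: a positive proportion of them can be chosen so that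
their distances to the interval are pairwise close to each other or far from each other. -/
theorem exists_separated (K : ℕ) (hK : 1 ≤ K) : ∃ M : ℕ, ∀ {ι : Type*} (h : ι → ℝ) (R : Finset ι)
    (n : ℕ) (x L : ℝ), 0 ≤ L → (∀ b ∈ R, x + (K + 1) * L ≤ h b) → M * n ≤ #R →
    ∃ A ⊆ R, n ≤ #A ∧ ∀ b ∈ A, ∀ b' ∈ A, ∀ y, x ≤ y → y ≤ x + L → h b ≤ h b' →
      K * (h b - y) ≤ h b' - h b ∨ K * (h b' - h b) ≤ h b - y := by
  have hK' : (1 : ℝ) ≤ K := by exact_mod_cast hK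
  -- Distances within a factor `ρ` differ by at most `1 / (2 * K)` of the smaller one. The choice of
  -- `m` makes `ρ ^ m` at least `K + 1`.
  set ρ : ℝ := 1 + 1 / (2 * K) with hρ
  have hρ1 : 1 < ρ := by rw [hρ]; have : (0 : ℝ) < 1 / (2 * K) := by positivity
                         linarith
  have hl : 0 < Real.log ρ := Real.log_pos hρ1
  obtain ⟨m, hm⟩ := exists_nat_ge (Real.log (K + 1) / Real.log ρ)
  rw [div_le_iff₀ hl] at hm
  refine ⟨m + 1, fun h R n x L hL hR hcard => ?_⟩
  -- Distances from `x` are sorted by scale `⌊log_ρ⌋`, and one residue class of scales modulo `m +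
  -- 1` is kept: two points then share a scale or are at least a factor `ρ ^ m` apart.
  set cls : _ → ℤ := fun b => ⌊Real.log (h b - x) / Real.log ρ⌋ with hcls
  have hmaps : ∀ b ∈ R, cls b % ((m + 1 : ℕ) : ℤ) ∈ Ico (0 : ℤ) ((m + 1 : ℕ) : ℤ) := fun b _ =>
    mem_Ico.2 ⟨Int.emod_nonneg _ (by positivity), Int.emod_lt_of_pos _ (by positivity)⟩
  obtain ⟨z, -, hz⟩ := exists_le_card_fiber_of_mul_le_card_of_maps_to hmaps
    ⟨0, by simp⟩ (n := n) (by simpa using hcard)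
  refine ⟨_, filter_subset _ _, hz, fun b hb b' hb' y hxy hyL hbb' => ?_⟩
  obtain ⟨hbR, hbz⟩ := mem_filter.1 hb
  obtain ⟨hbR', hbz'⟩ := mem_filter.1 hb'
  have h1 := hR b hbR
  have hLK : L ≤ K * L := le_mul_of_one_le_left hL hK'
  have hD0 : 0 ≤ h b - x := by nlinarith
  rcases hD0.eq_or_lt with hD0 | hD
  · left
    have : K * (h b - y) ≤ K * 0 := by gcongr; linarith
    linarith
  have hD' : 0 < h b' - x := by linarith
  have hlog : Real.log (h b - x) ≤ Real.log (h b' - x) := Real.log_le_log hD (by linarith)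
  have hle : cls b ≤ cls b' := Int.floor_le_floor (by gcongr)
  have f1 : cls b * Real.log ρ ≤ Real.log (h b - x) := by
    rw [← le_div_iff₀ hl]; exact Int.floor_le _
  have f2 : Real.log (h b - x) < (cls b + 1) * Real.log ρ := by
    rw [← div_lt_iff₀ hl]; exact Int.lt_floor_add_one _
  have f1' : cls b' * Real.log ρ ≤ Real.log (h b' - x) := by
    rw [← le_div_iff₀ hl]; exact Int.floor_le _
  have f2' : Real.log (h b' - x) < (cls b' + 1) * Real.log ρ := by
    rw [← div_lt_iff₀ hl]; exact Int.lt_floor_add_one _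
  rcases hle.eq_or_lt with heq | hlt
  · right
    rw [← heq] at f2'
    have h3 : Real.log (h b' - x) ≤ Real.log (ρ * (h b - x)) := by
      rw [Real.log_mul (by positivity) hD.ne']; linarith
    have h4 : h b' - x ≤ ρ * (h b - x) := (Real.log_le_log_iff hD' (by positivity)).1 h3
    have h5 : K * (h b' - h b) ≤ K * ((1 / (2 * K)) * (h b - x)) := by
      gcongr; rw [hρ] at h4; linarith
    have h6 : K * ((1 / (2 * K)) * (h b - x)) = (h b - x) / 2 := by field_simp
    nlinarith
  · left
    have hdvd : ((m + 1 : ℕ) : ℤ) ∣ cls b' - cls b :=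
      Int.ModEq.dvd (show cls b % _ = cls b' % _ by rw [hbz, hbz'])
    have h3 : ((m + 1 : ℕ) : ℤ) ≤ cls b' - cls b := Int.le_of_dvd (by omega) hdvd
    have h4 : (m : ℝ) + 1 ≤ cls b' - cls b := by exact_mod_cast h3
    have h5 : Real.log ((K + 1) * (h b - x)) ≤ Real.log (h b' - x) := by
      rw [Real.log_mul (by positivity) hD.ne']
      nlinarith
    have h6 := (Real.log_le_log_iff (by positivity) hD').1 h5
    have h7 : K * (h b - y) ≤ K * (h b - x) := by gcongr
    linarith

open Classical in
/-- Two sets of points whose lacunary subsets can be joined. -/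
def CrossLacunary (K : ℕ) (h : ι → ℝ) (A₁ A₂ : Finset ι) : Prop :=
  ∀ B₁ ⊆ A₁, ∀ B₂ ⊆ A₂, Lacunary K h B₁ → Lacunary K h B₂ → Lacunary K h (B₁ ∪ B₂)

theorem CrossLacunary.neg {K : ℕ} {h : ι → ℝ} {A₁ A₂ : Finset ι}
    (hA : CrossLacunary K (-h) A₁ A₂) : CrossLacunary K h A₁ A₂ := by
  intro B₁ h1 B₂ h2 hB1 hB2
  simpa using (hA B₁ h1 B₂ h2 hB1.neg hB2.neg).neg

/-- In a mixed triple with two points of `A₁`, the gap to the far point is at least `K * L`, hence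
the larger one; with one point of `A₁`, `exists_separated` applies. -/
theorem exists_crossLacunary_right (K : ℕ) (hK : 1 ≤ K) : ∃ M : ℕ, ∀ {ι : Type*} (h : ι → ℝ)
    (A₁ R : Finset ι) (n : ℕ) (x L : ℝ), 0 ≤ L → (∀ a ∈ A₁, x ≤ h a ∧ h a ≤ x + L) →
    (∀ b ∈ R, x + (K + 1) * L ≤ h b) → M * n ≤ #R →
    ∃ A₂ ⊆ R, n ≤ #A₂ ∧ CrossLacunary K h A₁ A₂ := by
  classical
  obtain ⟨M, hM⟩ := exists_separated K hK
  refine ⟨M, fun h A₁ R n x L hL hA₁ hR hcard => ?_⟩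
  obtain ⟨A₂, hA₂, hn, hsep⟩ := hM h R n x L hL hR hcard
  have hK' : (1 : ℝ) ≤ K := by exact_mod_cast hK
  have hLK : L ≤ K * L := le_mul_of_one_le_left hL hK'
  refine ⟨A₂, hA₂, hn, fun B₁ h1 B₂ h2 hB1 hB2 => ?_⟩
  -- Triples in the wrong order occur only in the degenerate case `L = 0`, where the two values
  -- coincide.
  have lem : ∀ a ∈ B₁, ∀ b ∈ B₂, h b ≤ h a → h b = h a ∧ L = 0 := by
    intro a ha b hb hba
    have e1 := hA₁ a (h1 ha)
    have e2 := hR b (hA₂ (h2 hb))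
    have : L = 0 := by nlinarith
    subst this
    exact ⟨by linarith, rfl⟩
  have haa : ∀ a ∈ B₁, ∀ a' ∈ B₁, ∀ b ∈ B₂, K * (h a' - h a) ≤ h b - h a' := by
    intro a ha a' ha' b hb
    have e1 := hA₁ a (h1 ha)
    have e1' := hA₁ a' (h1 ha')
    have e2 := hR b (hA₂ (h2 hb))
    have : K * (h a' - h a) ≤ K * L := by gcongr; linarith
    linarith
  intro u hu v hv w hw huv hvw
  rcases mem_union.1 hu with hu | hu <;> rcases mem_union.1 hv with hv | hv <;>
    rcases mem_union.1 hw with hw | hw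
  · exact hB1 u hu v hv w hw huv hvw
  · exact Or.inl (haa u hu v hv w hw)
  · right
    rw [(lem w hw v hv hvw).1, sub_self, mul_zero]; linarith
  · exact hsep v (h2 hv) w (h2 hw) (h u) (hA₁ u (h1 hu)).1
      (hA₁ u (h1 hu)).2 hvw
  · left
    rw [(lem v hv u hu huv).1, sub_self, mul_zero]; linarith
  · left
    rw [(lem v hv u hu huv).1, sub_self, mul_zero]; linarith
  · right
    rw [(lem w hw v hv hvw).1, sub_self, mul_zero]; linarith
  · exact hB2 u hu v hv w hw huv hvw

/-- `A₁` lies in a shortest interval `[x, x + L]` holding `n` points. By minimality few points are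
near it, so most lie far to one side; the left side is reflected to the right. -/
theorem exists_crossLacunary (K : ℕ) (hK : 1 ≤ K) : ∃ q : ℕ, ∀ {ι : Type*} (h : ι → ℝ) (n : ℕ)
    (A : Finset ι), 0 < n → q * n ≤ #A → ∃ A₁ ⊆ A, ∃ A₂ ⊆ A, Disjoint A₁ A₂ ∧ n ≤ #A₁ ∧ n ≤ #A₂ ∧
      CrossLacunary K h A₁ A₂ := by
  classical
  obtain ⟨M, hM⟩ := exists_crossLacunary_right K hK
  -- The budget is `n` points for `A₁`, `(2 * K + 1) * n` for the neighbourhood `Z`, and `M * n` for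
  -- each side.
  refine ⟨2 * M + 2 * K + 2, fun {ι} h n A hn hcard => ?_⟩
  set I : ι × ι → Finset ι := fun e => A.filter (fun b => h e.1 ≤ h b ∧ h b ≤ h e.2) with hI
  set E := (A ×ˢ A).filter (fun e => n ≤ #(I e)) with hE
  have key : ∀ S ⊆ A, n ≤ #S → ∃ e ∈ E, e.1 ∈ S ∧ e.2 ∈ S := by
    intro S hS hnS
    have hne : S.Nonempty := card_pos.1 (by omega)
    obtain ⟨u, hu, hu'⟩ := exists_min_image S h hne
    obtain ⟨v, hv, hv'⟩ := exists_max_image S h hne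
    refine ⟨(u, v), mem_filter.2 ⟨mem_product.2 ⟨hS hu, hS hv⟩, hnS.trans (card_le_card ?_)⟩,
      hu, hv⟩
    exact fun b hb => mem_filter.2 ⟨hS hb, hu' b hb, hv' b hb⟩
  have hnA : n ≤ #A := by nlinarith
  obtain ⟨e₀, he₀, -⟩ := key A subset_rfl hnA
  obtain ⟨e, he, hmin⟩ := exists_min_image E (fun e => h e.2 - h e.1) ⟨e₀, he₀⟩
  set x := h e.1
  set L := h e.2 - h e.1 with hLdef
  obtain ⟨A₁, hA₁, hA₁n⟩ := exists_subset_card_eq (mem_filter.1 he).2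
  have hA₁A : A₁ ⊆ A := hA₁.trans (filter_subset _ _)
  have hA₁x : ∀ a ∈ A₁, x ≤ h a ∧ h a ≤ x + L := fun a ha => by
    have := (mem_filter.1 (hA₁ ha)).2
    exact ⟨this.1, by rw [hLdef]; linarith [this.2]⟩
  have hL : 0 ≤ L := by
    obtain ⟨a, ha⟩ := card_pos.1 (hA₁n ▸ hn)
    linarith [(hA₁x a ha).1, (hA₁x a ha).2]
  set R := (A \ A₁).filter (fun b => x + (K + 1) * L ≤ h b) with hR
  set R' := (A \ A₁).filter (fun b => h b ≤ x - K * L) with hR'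
  set Z := A.filter (fun b => x - K * L < h b ∧ h b < x + (K + 1) * L) with hZ
  have hZcard : #Z ≤ (2 * K + 1) * n := by
    by_contra hlt
    push Not at hlt
    have hZne : Z.Nonempty := card_pos.1 (by omega)
    obtain ⟨b₀, hb₀⟩ := hZne
    have hLpos : 0 < L := by
      have := (mem_filter.1 hb₀).2
      by_contra hL0
      have : L = 0 := le_antisymm (not_lt.1 hL0) hL
      simp only [this] at *
      linarith
    -- `Z` is cut into `2 * K + 1` half-open cells of length `L`; a cell with `n` points would give
    -- an interval strictly shorter than `L`.
    have hmaps : ∀ b ∈ Z, ⌊(h b - x) / L⌋ ∈ Ico (-(K : ℤ)) (K + 1) := by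
      intro b hb
      obtain ⟨-, h1, h2⟩ := mem_filter.1 hb
      rw [mem_Ico, Int.le_floor, Int.floor_lt, le_div_iff₀ hLpos, div_lt_iff₀ hLpos]
      push_cast
      constructor <;> linarith
    have hc : #(Ico (-(K : ℤ)) (K + 1)) * n < #Z := by
      rw [Int.card_Ico]
      have : ((K : ℤ) + 1 - -(K : ℤ)).toNat = 2 * K + 1 := by omega
      rwa [this]
    obtain ⟨z, -, hz⟩ := exists_lt_card_fiber_of_mul_lt_card_of_maps_to hmaps hc
    obtain ⟨e', he', h1, h2⟩ := key _ ((filter_subset _ _).trans (filter_subset _ _)) hz.le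
    have h3 := hmin e' he'
    have g1 := (mem_filter.1 h1).2
    have g2 := (mem_filter.1 h2).2
    have k1 := Int.floor_le ((h e'.1 - x) / L)
    have k2 := Int.lt_floor_add_one ((h e'.2 - x) / L)
    rw [g1] at k1
    rw [g2] at k2
    have k3 : (h e'.2 - x) / L - (h e'.1 - x) / L < 1 := by linarith
    rw [← sub_div, div_lt_one hLpos] at k3
    have : L ≤ h e'.2 - h e'.1 := h3
    linarith
  have hcover : A ⊆ A₁ ∪ Z ∪ (R ∪ R') := by
    intro b hb
    simp only [mem_union, hR, hR', hZ, mem_filter, mem_sdiff]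
    by_cases hb1 : b ∈ A₁
    · tauto
    rcases le_or_gt (x + (K + 1) * L) (h b) with c1 | c1
    · tauto
    rcases le_or_gt (h b) (x - K * L) with c2 | c2
    · tauto
    · tauto
  have hcc := (card_le_card hcover).trans ((card_union_le _ _).trans
    (Nat.add_le_add (card_union_le _ _) (card_union_le _ _)))
  have hsum : 2 * (M * n) ≤ #R + #R' := by nlinarith
  have hdisj : ∀ S, S ⊆ A \ A₁ → Disjoint A₁ S := fun S hS =>
    (disjoint_sdiff (s := A₁) (t := A)).mono_right hS
  rcases le_or_gt (M * n) #R with hc | hc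
  · obtain ⟨A₂, hA₂, hn2, hcr⟩ := hM h A₁ R n x L hL hA₁x (fun b hb => (mem_filter.1 hb).2) hc
    have hs : A₂ ⊆ A \ A₁ := hA₂.trans (filter_subset _ _)
    exact ⟨A₁, hA₁A, A₂, hs.trans sdiff_subset, hdisj _ hs, hA₁n.ge, hn2, hcr⟩
  · obtain ⟨A₂, hA₂, hn2, hcr⟩ := hM (-h) A₁ R' n (-(x + L)) L hL
      (fun a ha => ⟨by simpa using (hA₁x a ha).2, by simpa using (hA₁x a ha).1⟩)
      (fun b hb => by
        have := (mem_filter.1 hb).2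
        simp only [Pi.neg_apply]; linarith) (by omega)
    have hs : A₂ ⊆ A \ A₁ := hA₂.trans (filter_subset _ _)
    exact ⟨A₁, hA₁A, A₂, hs.trans sdiff_subset, hdisj _ hs, hA₁n.ge, hn2, hcr.neg⟩

/-- Splitting recursively doubles the output while the input grows by a constant factor, which gives
a polynomial bound. -/
theorem exists_lacunary (K : ℕ) (hK : 1 ≤ K) : ∃ C : ℕ, ∀ {ι : Type*} (h : ι → ℝ) (n : ℕ)
    (A : Finset ι), n ^ C ≤ #A → ∃ B ⊆ A, n ≤ #B ∧ Lacunary K h B := by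
  classical
  obtain ⟨q, hq⟩ := exists_crossLacunary K hK
  refine ⟨2 * q + 1, fun {ι} h n A hcard => ?_⟩
  have main : ∀ (s : ℕ) (A : Finset ι), (2 ^ q) ^ s ≤ #A →
      ∃ B ⊆ A, 2 ^ s ≤ #B ∧ Lacunary K h B := by
    intro s
    induction s with
    | zero =>
      intro A hA
      obtain ⟨B, hBA, hB⟩ := exists_subset_card_eq hA
      exact ⟨B, hBA, by simpa using hB.ge, lacunary_of_card_le_one (by simp [hB])⟩
    | succ s ih =>
      intro A hA
      have h1 : q * (2 ^ q) ^ s ≤ #A := by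
        refine le_trans ?_ hA
        rw [pow_succ, mul_comm]
        gcongr
        exact Nat.lt_two_pow_self.le
      obtain ⟨A₁, hA₁, A₂, hA₂, hd, hn1, hn2, hcr⟩ := hq h _ A (by positivity) h1
      obtain ⟨B₁, hB₁, hc1, hl1⟩ := ih A₁ hn1
      obtain ⟨B₂, hB₂, hc2, hl2⟩ := ih A₂ hn2
      refine ⟨B₁ ∪ B₂, union_subset (hB₁.trans hA₁) (hB₂.trans hA₂), ?_, ?_⟩
      · rw [card_union_of_disjoint (hd.mono hB₁ hB₂), pow_succ]; omega
      · convert hcr B₁ hB₁ B₂ hB₂ hl1 hl2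
  rcases Nat.lt_or_ge n 2 with hn | hn
  · have hn3 : n ^ (2 * q + 1) = n := by interval_cases n <;> simp
    obtain ⟨B, hBA, hB⟩ := exists_subset_card_eq (hn3 ▸ hcard)
    exact ⟨B, hBA, hB.ge, lacunary_of_card_le_one (by omega)⟩
  obtain ⟨B, hBA, hB, hl⟩ := main (Nat.clog 2 n) A (by
    refine le_trans ?_ hcard
    have h1 : 2 ^ Nat.clog 2 n ≤ n * n := by
      have h2 : 2 ^ (Nat.clog 2 n).pred < n := Nat.pow_pred_clog_lt_self one_lt_two (by omega)
      have h3 : 0 < Nat.clog 2 n := Nat.clog_pos one_lt_two hn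
      obtain ⟨k, hk⟩ := Nat.exists_eq_succ_of_ne_zero h3.ne'
      rw [hk] at h2 ⊢
      simp only [Nat.pred_succ] at h2
      rw [Nat.succ_eq_add_one, pow_succ]; nlinarith
    calc (2 ^ q) ^ Nat.clog 2 n = (2 ^ Nat.clog 2 n) ^ q := by rw [← pow_mul, ← pow_mul, mul_comm]
      _ ≤ (n * n) ^ q := by gcongr
      _ = n ^ (2 * q) := by rw [← sq, ← pow_mul]
      _ ≤ n ^ (2 * q + 1) := Nat.pow_le_pow_right (by omega) (by omega))
  exact ⟨B, hBA, (Nat.le_pow_clog one_lt_two n).trans hB, hl⟩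

end Thinning

/-! ### Monotone paths with monochromatic consecutive triples. -/

section Paths

variable {ι Γ : Type*} [LinearOrder ι]

/-- There is a monotone path in `A` with `n + 1` edges and last edge `v < w`, all of whose `n`
consecutive triples have colour `c`. -/
def IsMonoPath (A : Finset ι) (χ : ι → ι → ι → Γ) (c : Γ) : ℕ → ι → ι → Prop
  | 0, v, w => v ∈ A ∧ w ∈ A ∧ v < w
  | n + 1, v, w => w ∈ A ∧ v < w ∧ ∃ u, IsMonoPath A χ c n u v ∧ χ u v w = c

/-- If no such path exists, each pair `v < w` has a label in `Γ → Fin n`, giving for each colour a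
path length that ends in that pair but cannot be increased by one. Among more than `2 ^ (n ^ |Γ|)`
vertices, two have the same set `D` of attainable labels. The label of this pair is then attained at
some `u < v`, and the path of colour `χ u v w` extends, a contradiction. -/
theorem exists_isMonoPath [Fintype Γ] (A : Finset ι) (χ : ι → ι → ι → Γ) (n : ℕ)
    (hA : 2 ^ (n ^ Fintype.card Γ) < #A) : ∃ c v w, IsMonoPath A χ c n v w := by
  classical
  by_contra! hno
  have hlab : ∀ v ∈ A, ∀ w ∈ A, v < w → ∀ c, ∃ l : Fin n, IsMonoPath A χ c l v w ∧
      ¬ IsMonoPath A χ c (l + 1) v w := by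
    intro v hv w hw hvw c
    by_contra! h
    have : ∀ l, l ≤ n → IsMonoPath A χ c l v w := by
      intro l
      induction l with
      | zero => exact fun _ => ⟨hv, hw, hvw⟩
      | succ l ih => exact fun hl => h ⟨l, hl⟩ (ih (by omega))
    exact hno c v w (this n le_rfl)
  set D : ι → Finset (Γ → Fin n) := fun v =>
    univ.filter (fun f => ∃ u, u ∈ A ∧ u < v ∧ ∀ c, IsMonoPath A χ c (f c) u v) with hD
  have hcard : #(univ : Finset (Finset (Γ → Fin n))) < #A := by
    simpa using hA
  obtain ⟨v, hv, w, hw, hne, heq⟩ :=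
    exists_ne_map_eq_of_card_lt_of_maps_to hcard (f := D) (fun _ _ => mem_univ _)
  wlog hvw : v < w generalizing v w
  · exact this w hw v hv hne.symm heq.symm (lt_of_le_of_ne (not_lt.1 hvw) hne.symm)
  choose f hf hf' using hlab v hv w hw hvw
  have hmem : f ∈ D w := mem_filter.2 ⟨mem_univ _, v, hv, hvw, hf⟩
  rw [← heq] at hmem
  obtain ⟨-, u, -, -, hu⟩ := mem_filter.1 hmem
  exact hf' (χ u v w) ⟨hw, hvw, u, hu _, rfl⟩

theorem IsMonoPath.exists_seq {A : Finset ι} {χ : ι → ι → ι → Γ} {c : Γ} {n : ℕ} {v w : ι}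
    (h : IsMonoPath A χ c n v w) : ∃ s : ℕ → ι, s n = v ∧ s (n + 1) = w ∧
      (∀ i ≤ n + 1, s i ∈ A) ∧ (∀ i ≤ n, s i < s (i + 1)) ∧
      ∀ i < n, χ (s i) (s (i + 1)) (s (i + 2)) = c := by
  induction n generalizing v w with
  | zero =>
    obtain ⟨hv, hw, hvw⟩ := h
    refine ⟨fun i => if i = 0 then v else w, by simp, by simp, ?_, ?_, by simp⟩
    · intro i _
      dsimp only
      split_ifs
      exacts [hv, hw]
    · intro i hi
      obtain rfl : i = 0 := by omega
      simpa using hvw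
  | succ n ih =>
    obtain ⟨hw, hvw, u, hu, hχ⟩ := h
    obtain ⟨s, h1, h2, h3, h4, h5⟩ := ih hu
    have e1 : ∀ i, i ≤ n + 1 → (fun i => if i ≤ n + 1 then s i else w) i = s i := fun i hi => by
      simp [hi]
    have e2 : (fun i => if i ≤ n + 1 then s i else w) (n + 2) = w := by simp
    refine ⟨fun i => if i ≤ n + 1 then s i else w, ?_, e2, ?_, ?_, ?_⟩
    · rw [e1 _ le_rfl, h2]
    · intro i hi
      rcases (show i ≤ n + 1 ∨ i = n + 2 by omega) with hi | rfl
      · rw [e1 i hi]; exact h3 i hi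
      · rw [e2]; exact hw
    · intro i hi
      rcases (show i ≤ n ∨ i = n + 1 by omega) with hi | rfl
      · rw [e1 i (by omega), e1 (i + 1) (by omega)]; exact h4 i hi
      · rw [e1 (n + 1) le_rfl, e2, h2]; exact hvw
    · intro i hi
      rcases (show i < n ∨ i = n by omega) with hi | rfl
      · rw [e1 i (by omega), e1 (i + 1) (by omega), e1 (i + 2) (by omega)]; exact h5 i hi
      · rw [e1 i (by omega), e1 (i + 1) le_rfl, e2, h1, h2]; exact hχ

end Paths

/-! ### From lacunary sequences to geometric growth around a centre. -/

section Geometric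

/-- If the increments of a sequence grow geometrically, so do the distances to its first term. -/
theorem abs_sub_zero_growth (x : ℕ → ℝ) (K : ℝ) (hK : 3 ≤ K) (n : ℕ)
    (h : ∀ i < n, K * |x (i + 1) - x i| ≤ |x (i + 2) - x (i + 1)|) :
    ∀ i ≤ n, (K - 2) * |x i - x 0| ≤ |x (i + 1) - x 0| := by
  -- The bound by the next increment is the one that passes through the induction; the triangle
  -- inequality then costs one more unit of `K`.
  have h1 : ∀ i ≤ n, (K - 1) * |x i - x 0| ≤ |x (i + 1) - x i| := by
    intro i
    induction i with
    | zero => intro _; simp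
    | succ i ih =>
      intro hi
      have e1 := ih (by omega)
      have e2 := h i (by omega)
      have e3 : |x (i + 1) - x 0| ≤ |x (i + 1) - x i| + |x i - x 0| := abs_sub_le _ _ _
      nlinarith
  intro i hi
  have e1 := h1 i hi
  have e2 : |x (i + 1) - x i| ≤ |x (i + 1) - x 0| + |x i - x 0| := by
    rw [abs_sub_comm (x i)]; exact abs_sub_le _ _ _
  linarith

theorem mul_le_of_consecutive (y : ℕ → ℝ) (K : ℝ) (hK : 1 ≤ K) (hy : ∀ i, 0 ≤ y i) (n : ℕ)
    (h : ∀ i, 1 ≤ i → i < n → K * y i ≤ y (i + 1)) :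
    ∀ i j, 1 ≤ i → i < j → j ≤ n → K * y i ≤ y j := by
  intro i j hi hij
  induction j, hij using Nat.le_induction with
  | base => intro hj; exact h i hi (by omega)
  | succ j hij ih =>
    intro hj
    have e1 := ih (by omega)
    have e2 := h j (by omega) (by omega)
    nlinarith [hy j]

variable {ι : Type*} [LinearOrder ι]

/-- The distances from `c` to the values of `h` on `B` grow or decay geometrically. -/
def GeometricAround (K : ℝ) (h : ι → ℝ) (c : ℝ) (B : Finset ι) : Prop :=
  (∃ σ : SignType, ∀ v ∈ B, SignType.sign (h v - c) = σ) ∧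
  ((∀ v ∈ B, ∀ w ∈ B, v < w → K * |h v - c| ≤ |h w - c|) ∨
    (∀ v ∈ B, ∀ w ∈ B, v < w → K * |h w - c| ≤ |h v - c|))

theorem GeometricAround.mono {K : ℝ} {h : ι → ℝ} {c : ℝ} {A B : Finset ι}
    (hB : GeometricAround K h c B) (hAB : A ⊆ B) : GeometricAround K h c A :=
  ⟨hB.1.imp fun _ hσ v hv => hσ v (hAB hv),
    hB.2.imp (fun h v hv w hw => h v (hAB hv) w (hAB hw))
      (fun h v hv w hw => h v (hAB hv) w (hAB hw))⟩

theorem Lacunary.abs_sub_le_or {K : ℕ} {h : ι → ℝ} {A : Finset ι} (hL : Lacunary K h A)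
    (hS : SignHom h A) {u v w : ι} (hu : u ∈ A) (hv : v ∈ A) (hw : w ∈ A) (huv : u < v)
    (hvw : v < w) : K * |h v - h u| ≤ |h w - h v| ∨ K * |h w - h v| ≤ |h v - h u| := by
  obtain ⟨σ, hσ⟩ := hS
  have h1 := hσ u hu v hv huv
  have h2 := hσ v hv w hw hvw
  have key : (h u ≤ h v ∧ h v ≤ h w) ∨ (h v ≤ h u ∧ h w ≤ h v) := by
    rcases lt_trichotomy σ 0 with h0 | h0 | h0
    · have : σ = -1 := by clear h1 h2 hσ; revert σ; decide
      rw [this, sign_eq_neg_one_iff] at h1 h2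
      exact Or.inr ⟨by linarith, by linarith⟩
    · rw [h0, sign_eq_zero_iff] at h1 h2
      exact Or.inr ⟨by linarith, by linarith⟩
    · have : σ = 1 := by clear h1 h2 hσ; revert σ; decide
      rw [this, sign_eq_one_iff] at h1 h2
      exact Or.inl ⟨by linarith, by linarith⟩
  rcases key with ⟨k1, k2⟩ | ⟨k1, k2⟩
  · rw [abs_of_nonneg (by linarith : 0 ≤ h v - h u), abs_of_nonneg (by linarith : 0 ≤ h w - h v)]
    exact hL u hu v hv w hw k1 k2
  · rw [abs_of_nonpos (by linarith : h v - h u ≤ 0), abs_of_nonpos (by linarith : h w - h v ≤ 0)]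
    rcases hL w hw v hv u hu k2 k1 with h | h
    · right; linarith
    · left; linarith

theorem exists_geometricAround {T : Type*} [Fintype T] (K : ℕ) (hK : 3 ≤ K) (h : T → ι → ℝ)
    (A : Finset ι) (hL : ∀ t, Lacunary K (h t) A) (hS : ∀ t, SignHom (h t) A) (n : ℕ)
    (hA : 2 ^ (n ^ 2 ^ Fintype.card T) < #A) :
    ∃ B ⊆ A, n ≤ #B ∧ ∀ t, ∃ c, GeometricAround ((K : ℝ) - 2) (h t) c B := by
  classical
  have hK3 : (3 : ℝ) ≤ K := by exact_mod_cast hK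
  set χ : ι → ι → ι → (T → Bool) := fun u v w t =>
    decide (K * |h t v - h t u| ≤ |h t w - h t v|) with hχ
  obtain ⟨c, v, w, hp⟩ := exists_isMonoPath A χ n (by simpa using hA)
  obtain ⟨s, -, -, hsA, hlt, hcol⟩ := hp.exists_seq
  have hmono : ∀ i j, i < j → j ≤ n + 1 → s i < s j := by
    intro i j hij
    induction j, hij using Nat.le_induction with
    | base => exact fun hj => hlt i (by omega)
    | succ j hij ih => exact fun hj => (ih (by omega)).trans (hlt j (by omega))
  have hord : ∀ i j, i ≤ n + 1 → s i < s j → i < j := by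
    intro i j hi hij
    by_contra hji
    rcases (not_lt.1 hji).eq_or_lt with h | h
    · subst h; exact lt_irrefl _ hij
    · exact (hmono j i h hi).asymm hij
  -- Both ends of the path are left out: the centre is the value at `s 0` if the gaps grow and at `s
  -- (n + 1)` if they decay, and this depends on `t`.
  refine ⟨(Icc 1 n).image s, ?_, ?_, fun t => ?_⟩
  · intro x hx
    obtain ⟨i, hi, rfl⟩ := mem_image.1 hx
    exact hsA i (by have := mem_Icc.1 hi; omega)
  · rw [card_image_of_injOn]
    · simp
    · intro i hi j hj hij
      have hi := mem_Icc.1 (mem_coe.1 hi)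
      have hj := mem_Icc.1 (mem_coe.1 hj)
      by_contra hne
      rcases lt_or_gt_of_ne hne with hl | hl
      · exact (hmono i j hl (by omega)).ne hij
      · exact (hmono j i hl (by omega)).ne hij.symm
  obtain ⟨σ, hσ⟩ := hS t
  cases hc : c t with
  | true =>
    have hstep : ∀ i < n, K * |h t (s (i + 1)) - h t (s i)| ≤
        |h t (s (i + 2)) - h t (s (i + 1))| := by
      intro i hi
      have := congrFun (hcol i hi) t
      rw [hc] at this
      exact of_decide_eq_true this
    have hgr := abs_sub_zero_growth (fun i => h t (s i)) K hK3 n hstep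
    refine ⟨h t (s 0), ⟨σ, ?_⟩, Or.inl ?_⟩
    · intro x hx
      obtain ⟨i, hi, rfl⟩ := mem_image.1 hx
      have hi := mem_Icc.1 hi
      exact hσ _ (hsA 0 (by omega)) _ (hsA i (by omega)) (hmono 0 i (by omega) (by omega))
    · intro x hx y hy hxy
      obtain ⟨i, hi, rfl⟩ := mem_image.1 hx
      obtain ⟨j, hj, rfl⟩ := mem_image.1 hy
      have hi := mem_Icc.1 hi
      have hj := mem_Icc.1 hj
      exact mul_le_of_consecutive (fun i => |h t (s i) - h t (s 0)|) (K - 2) (by linarith)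
        (fun _ => abs_nonneg _) n (fun i _ hi => hgr i hi.le) i j hi.1
        (hord i j (by omega) hxy) hj.2
  | false =>
    have hstep : ∀ i < n, K * |h t (s (i + 2)) - h t (s (i + 1))| ≤
        |h t (s (i + 1)) - h t (s i)| := by
      intro i hi
      have := congrFun (hcol i hi) t
      rw [hc] at this
      exact ((hL t).abs_sub_le_or ⟨σ, hσ⟩ (hsA i (by omega)) (hsA (i + 1) (by omega))
        (hsA (i + 2) (by omega)) (hlt i (by omega)) (hlt (i + 1) (by omega))).resolve_left
          (of_decide_eq_false this)
    have hgr := abs_sub_zero_growth (fun i => h t (s (n + 1 - i))) K hK3 n (by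
      intro i hi
      have := hstep (n - 1 - i) (by omega)
      have e0 : n + 1 - i = n - 1 - i + 2 := by omega
      have e1 : n + 1 - (i + 1) = n - 1 - i + 1 := by omega
      have e2 : n + 1 - (i + 2) = n - 1 - i := by omega
      simp only [e0, e1, e2]
      rwa [abs_sub_comm (h t (s (n - 1 - i + 1))), abs_sub_comm (h t (s (n - 1 - i)))])
    refine ⟨h t (s (n + 1)), ⟨-σ, ?_⟩, Or.inr ?_⟩
    · intro x hx
      obtain ⟨i, hi, rfl⟩ := mem_image.1 hx
      have hi := mem_Icc.1 hi
      rw [← hσ _ (hsA i (by omega)) _ (hsA (n + 1) le_rfl) (hmono i (n + 1) (by omega) le_rfl),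
        ← Left.sign_neg, neg_sub]
    · intro x hx y hy hxy
      obtain ⟨i, hi, rfl⟩ := mem_image.1 hx
      obtain ⟨j, hj, rfl⟩ := mem_image.1 hy
      have hi := mem_Icc.1 hi
      have hj := mem_Icc.1 hj
      have hij := hord i j (by omega) hxy
      have := mul_le_of_consecutive (fun i => |h t (s (n + 1 - i)) - h t (s (n + 1))|) (K - 2)
        (by linarith) (fun _ => abs_nonneg _) n (fun i _ hi => hgr i hi.le) (n + 1 - j) (n + 1 - i)
        (by omega) (by omega) (by omega)
      have e1 : n + 1 - (n + 1 - i) = i := by omega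
      have e2 : n + 1 - (n + 1 - j) = j := by omega
      simpa only [e1, e2] using this

end Geometric

/-! ### Signs of sums with a dominant term. -/

/-- A sum of functions of constant signs, the absolute values of any two of which compare in a
uniform way, is dominated by one of its terms and hence has constant sign. -/
theorem exists_sign_sum_eq {T X : Type*} [Fintype T] [Nonempty T] (val : T → X → ℝ)
    (hdom : ∀ t t', t ≠ t' → (∀ x, Fintype.card T * |val t x| ≤ |val t' x|) ∨
      (∀ x, Fintype.card T * |val t' x| ≤ |val t x|))
    (hsign : ∀ t, ∃ σ : SignType, ∀ x, SignType.sign (val t x) = σ) :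
    ∃ σ : SignType, ∀ x, SignType.sign (∑ t, val t x) = σ := by
  classical
  have hcard : (1 : ℝ) ≤ Fintype.card T := by exact_mod_cast Fintype.card_pos
  -- Domination is transitive and any two terms are comparable, so finitely many terms have a
  -- largest one.
  set r : T → T → Prop := fun t t' => t = t' ∨ ∀ x, Fintype.card T * |val t x| ≤ |val t' x| with hr
  have : IsTrans T r := ⟨by
    rintro a b c (rfl | hab) (rfl | hbc)
    · exact Or.inl rfl
    · exact Or.inr hbc
    · exact Or.inr hab
    · refine Or.inr fun x => (hab x).trans ?_
      nlinarith [hbc x, abs_nonneg (val b x)]⟩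
  have : IsDirected T r := ⟨by
    intro a b
    by_cases hab : a = b
    · exact ⟨a, Or.inl rfl, Or.inl hab.symm⟩
    rcases hdom a b hab with h | h
    · exact ⟨b, Or.inr h, Or.inl rfl⟩
    · exact ⟨a, Or.inl rfl, Or.inr h⟩⟩
  obtain ⟨z, hz⟩ := Directed.finset_le (r := r) (f := id) directed_id univ
  obtain ⟨σ, hσ⟩ := hsign z
  refine ⟨σ, fun x => ?_⟩
  rw [← hσ x, ← add_sum_erase univ (fun t => val t x) (mem_univ z)]
  have hle : ∀ t ∈ univ.erase z, Fintype.card T * |val t x| ≤ |val z x| := fun t ht =>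
    (hz t (mem_univ t)).resolve_left (ne_of_mem_erase ht) x
  have hrest : Fintype.card T * |∑ t ∈ univ.erase z, val t x| ≤
      (Fintype.card T - 1) * |val z x| := by
    calc (Fintype.card T : ℝ) * |∑ t ∈ univ.erase z, val t x|
        ≤ Fintype.card T * ∑ t ∈ univ.erase z, |val t x| := by
          gcongr; exact abs_sum_le_sum_abs _ _
      _ = ∑ t ∈ univ.erase z, Fintype.card T * |val t x| := mul_sum _ _ _
      _ ≤ ∑ t ∈ univ.erase z, |val z x| := sum_le_sum hle
      _ = (Fintype.card T - 1) * |val z x| := by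
          rw [sum_const, card_erase_of_mem (mem_univ z), card_univ, nsmul_eq_mul,
            Nat.cast_sub Fintype.card_pos, Nat.cast_one]
  set S := ∑ t ∈ univ.erase z, val t x
  have hS := abs_le.1 (le_refl |S|)
  rcases lt_trichotomy (val z x) 0 with h | h | h
  · rw [abs_of_neg h] at hrest
    rw [sign_neg h, sign_neg]
    nlinarith
  · rw [h, abs_zero, mul_zero] at hrest
    have : |S| ≤ 0 := by nlinarith [abs_nonneg S]
    rw [h, abs_nonpos_iff.1 this, add_zero]
  · rw [abs_of_pos h] at hrest
    rw [sign_pos h, sign_pos]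
    nlinarith

variable {ι : Type*} [LinearOrder ι]

/-- Otherwise `G w` is within a factor `κ` of `F v` for all `v < w`. Applied to `y < v < w`, this
puts `F y` and `F v` within a factor `κ * κ ≤ K`, against geometric growth. The element `y` serves
only as this witness. -/
theorem PairHom.dominates_of_lt {F G : ι → ℝ} {κ K : ℝ} (hκ : 1 ≤ κ) (hK : κ * κ ≤ K)
    {B : Finset ι} (hF : ∀ v, 0 ≤ F v)
    (h1 : PairHom (fun v => κ * F v) G B) (h2 : PairHom F (fun v => κ * G v) B)
    (hgeo : (∀ v ∈ B, ∀ w ∈ B, v < w → K * F v ≤ F w) ∨ (∀ v ∈ B, ∀ w ∈ B, v < w → K * F w ≤ F v))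
    {y : ι} (hy : y ∈ B) :
    (∀ v ∈ B, ∀ w ∈ B, y < v → v < w → κ * F v ≤ G w) ∨
      (∀ v ∈ B, ∀ w ∈ B, y < v → v < w → κ * G w ≤ F v) := by
  rcases h1 with h1 | h1
  · exact Or.inl fun v hv w hw _ hvw => (h1 v hv w hw hvw).le
  rcases h2 with h2 | h2
  swap
  · exact Or.inr fun v hv w hw _ hvw => h2 v hv w hw hvw
  left
  intro v hv w hw hyv hvw
  exfalso
  have a1 := h1 y hy w hw (hyv.trans hvw)
  have a2 := h2 y hy w hw (hyv.trans hvw)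
  have b1 := h1 v hv w hw hvw
  have b2 := h2 v hv w hw hvw
  simp only at a1 a2 b1 b2
  rcases hgeo with hg | hg
  · have := hg y hy v hv hyv
    nlinarith [hF y, mul_le_mul_of_nonneg_left a1 (by linarith : 0 ≤ κ),
      mul_le_mul_of_nonneg_right hK (hF y)]
  · have := hg y hy v hv hyv
    nlinarith [hF v, mul_le_mul_of_nonneg_left b1 (by linarith : 0 ≤ κ),
      mul_le_mul_of_nonneg_right hK (hF v)]

/-- If neither dominates, all values of `G` above `y` are within a factor `κ` of `c`; two such
values, available since `3 ≤ #B`, contradict geometric growth. -/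
theorem PairHom.const_dominates {G : ι → ℝ} {c κ K : ℝ} (hκ : 1 ≤ κ) (hK : κ * κ ≤ K)
    {B : Finset ι} (hG : ∀ v, 0 ≤ G v)
    (h1 : PairHom (fun _ => κ * c) G B) (h2 : PairHom (fun _ => c) (fun v => κ * G v) B)
    (hgeo : (∀ v ∈ B, ∀ w ∈ B, v < w → K * G v ≤ G w) ∨ (∀ v ∈ B, ∀ w ∈ B, v < w → K * G w ≤ G v))
    {y : ι} (hy : y ∈ B) (hmin : ∀ v ∈ B, y ≤ v) (hB : 3 ≤ #B) :
    (∀ v ∈ B, y < v → κ * c ≤ G v) ∨ (∀ v ∈ B, y < v → κ * G v ≤ c) := by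
  rcases h1 with h1 | h1
  · exact Or.inl fun v hv hyv => (h1 y hy v hv hyv).le
  rcases h2 with h2 | h2
  swap
  · exact Or.inr fun v hv hyv => h2 y hy v hv hyv
  left
  intro v hv hyv
  exfalso
  have key : ∀ p ∈ B, ∀ q ∈ B, y < p → y < q → ¬ K * G p ≤ G q := by
    intro p hp q hq hyp hyq h
    have a1 := h1 y hy q hq hyq
    have a2 := h2 y hy p hp hyp
    simp only at a1 a2
    nlinarith [mul_le_mul_of_nonneg_right hK (hG p),
      mul_lt_mul_of_pos_left a2 (by linarith : 0 < κ)]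
  obtain ⟨w, hw⟩ : ((B.erase y).erase v).Nonempty := card_pos.1 (by
    rw [card_erase_of_mem (mem_erase.2 ⟨hyv.ne', hv⟩), card_erase_of_mem hy]; omega)
  obtain ⟨hwv, hw⟩ := mem_erase.1 hw
  obtain ⟨hwy, hw⟩ := mem_erase.1 hw
  have hyw : y < w := lt_of_le_of_ne (hmin w hw) hwy.symm
  rcases lt_or_gt_of_ne hwv with hlt | hlt <;> rcases hgeo with hg | hg
  · exact key w hw v hv hyw hyv (hg w hw v hv hlt)
  · exact key v hv w hw hyv hyw (hg w hw v hv hlt)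
  · exact key v hv w hw hyv hyw (hg v hv w hw hlt)
  · exact key w hw v hv hyw hyv (hg v hv w hw hlt)

/-- The absolute values of the terms of `∑ a, g a (i a) = ∑ a, c a + ∑ a, (g a (i a) - c a)`. -/
def termSize {r : ℕ} (g : Fin r → ι → ℝ) (c : Fin r → ℝ) : Option (Fin r) → ι → ℝ
  | none, _ => |∑ a, c a|
  | some a, v => |g a v - c a|

/-- The sum `∑ a, g a (i a)` has the same sign for all increasing tuples `i` in `B`. -/
def TupleSignHom {r : ℕ} (g : Fin r → ι → ℝ) (B : Finset ι) : Prop :=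
  ∃ σ : SignType, ∀ i : Fin r → ι, StrictMono i → (∀ a, i a ∈ B) →
    SignType.sign (∑ a, g a (i a)) = σ

theorem tupleSignHom_of_geometricAround {r : ℕ} (g : Fin r → ι → ℝ) (c : Fin r → ℝ) {K : ℝ}
    (hK : ((r : ℝ) + 1) * (r + 1) ≤ K) {B : Finset ι} (hgeo : ∀ a, GeometricAround K (g a) (c a) B)
    (h1 : ∀ t t', PairHom (fun v => ((r : ℝ) + 1) * termSize g c t v) (termSize g c t') B)
    (h2 : ∀ t t', PairHom (termSize g c t) (fun v => ((r : ℝ) + 1) * termSize g c t' v) B)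
    {y : ι} (hy : y ∈ B) (hmin : ∀ v ∈ B, y ≤ v) (hB : 3 ≤ #B) :
    TupleSignHom g (B.erase y) := by
  have hκ : (1 : ℝ) ≤ r + 1 := by linarith [(Nat.cast_nonneg r : (0 : ℝ) ≤ r)]
  set X := {i : Fin r → ι // StrictMono i ∧ ∀ a, i a ∈ B.erase y}
  have hXB : ∀ (i : X) a, i.1 a ∈ B := fun i a => mem_of_mem_erase (i.2.2 a)
  have hXy : ∀ (i : X) a, y < i.1 a := fun i a =>
    lt_of_le_of_ne (hmin _ (hXB i a)) (ne_of_mem_erase (i.2.2 a)).symm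
  set val : Option (Fin r) → X → ℝ := fun t i =>
    t.elim (∑ a, c a) (fun a => g a (i.1 a) - c a) with hval
  have hcard : (Fintype.card (Option (Fin r)) : ℝ) = r + 1 := by simp
  have hconst : ∀ b : Fin r,
      (∀ x, Fintype.card (Option (Fin r)) * |val none x| ≤ |val (some b) x|) ∨
      (∀ x, Fintype.card (Option (Fin r)) * |val (some b) x| ≤ |val none x|) := by
    intro b
    rw [hcard]
    rcases PairHom.const_dominates (G := termSize g c (some b)) hκ hK (fun _ => abs_nonneg _)
      (h1 none (some b)) (h2 none (some b)) (hgeo b).2 hy hmin hB with h | h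
    · exact Or.inl fun x => h _ (hXB x b) (hXy x b)
    · exact Or.inr fun x => h _ (hXB x b) (hXy x b)
  have hpair : ∀ a b : Fin r, a < b →
      (∀ x, Fintype.card (Option (Fin r)) * |val (some a) x| ≤ |val (some b) x|) ∨
      (∀ x, Fintype.card (Option (Fin r)) * |val (some b) x| ≤ |val (some a) x|) := by
    intro a b hab
    rw [hcard]
    rcases PairHom.dominates_of_lt (F := termSize g c (some a)) hκ hK (fun _ => abs_nonneg _)
      (h1 (some a) (some b)) (h2 (some a) (some b)) (hgeo a).2 hy with h | h
    · exact Or.inl fun x => h _ (hXB x a) _ (hXB x b) (hXy x a) (x.2.1 hab)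
    · exact Or.inr fun x => h _ (hXB x a) _ (hXB x b) (hXy x a) (x.2.1 hab)
  obtain ⟨σ, hσ⟩ := exists_sign_sum_eq val
    (by
      rintro (_ | a) (_ | b) hne
      · exact absurd rfl hne
      · exact hconst b
      · exact (hconst a).symm
      · rcases lt_or_gt_of_ne (fun h => hne (congrArg some h)) with h | h
        · exact hpair a b h
        · exact (hpair b a h).symm)
    (by
      rintro (_ | a)
      · exact ⟨SignType.sign (∑ a, c a), fun _ => rfl⟩
      · obtain ⟨σ, hσ⟩ := (hgeo a).1
        exact ⟨σ, fun x => hσ _ (hXB x a)⟩)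
  refine ⟨σ, fun i hi hiB => ?_⟩
  rw [← hσ ⟨i, hi, hiB⟩, Fintype.sum_option]
  simp [hval, sum_sub_distrib]

/-- Ramsey's theorem for the signs of finitely many sums `∑ a, g j a (i a)`, with a bound that is
exponential in a power of the size of the homogeneous set. -/
theorem exists_tupleSignHom (r M : ℕ) : ∃ C : ℕ, ∀ {ι : Type*} [LinearOrder ι]
    (g : Fin M → Fin r → ι → ℝ) (n : ℕ) (A : Finset ι), 2 ≤ n → 2 ^ n ^ C ≤ #A →
    ∃ B ⊆ A, n ≤ #B ∧ ∀ j, TupleSignHom (g j) B := by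
  classical
  -- There are `r + 1` terms, so domination needs ratio `(r + 1) ^ 2`; passing to distances from a
  -- centre loses `2`.
  set K : ℕ := (r + 1) * (r + 1) + 2 with hKdef
  have hK3 : 3 ≤ K := by rw [hKdef]; nlinarith
  obtain ⟨C₁, hC₁⟩ := exists_lacunary K (by omega)
  set T := Fin M × Fin r
  set U := Fin M × Option (Fin r) × Option (Fin r)
  set E := (C₁ ^ #(univ : Finset T)) * (9 ^ #(univ : Finset T)) with hE
  set c := 3 ^ #(univ : Finset (U × Bool)) with hc
  set Q := 2 ^ Fintype.card T with hQ
  refine ⟨2 * c * Q + 1 + E, fun {ι} _ g n A hn hA => ?_⟩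
  -- The nested sizes are those of the successive thinnings read from the inside out; `n + 1` allows
  -- for deleting the least element at the end.
  have hsize : ((2 ^ (((n + 1) ^ c) ^ Q) + 1) ^ (C₁ ^ #(univ : Finset T))) ^
      (9 ^ #(univ : Finset T)) ≤ #A := by
    refine le_trans ?_ hA
    rw [← pow_mul, ← hE, ← pow_mul]
    have h1 : (n + 1) ^ (c * Q) ≤ n ^ (2 * c * Q) := by
      rw [mul_assoc, pow_mul n 2]
      gcongr; nlinarith
    have h2 : n ^ (2 * c * Q) + 1 ≤ n ^ (2 * c * Q + 1) := by
      have : 1 ≤ n ^ (2 * c * Q) := Nat.one_le_pow _ _ (by omega)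
      rw [pow_succ]; nlinarith
    have h3 : E ≤ n ^ E := (Nat.lt_pow_self (by omega)).le
    calc (2 ^ ((n + 1) ^ (c * Q)) + 1) ^ E ≤ (2 ^ ((n + 1) ^ (c * Q) + 1)) ^ E := by
          gcongr
          have : 1 ≤ 2 ^ ((n + 1) ^ (c * Q)) := Nat.one_le_two_pow
          rw [pow_succ]; omega
      _ = 2 ^ (((n + 1) ^ (c * Q) + 1) * E) := by rw [← pow_mul]
      _ ≤ 2 ^ (n ^ (2 * c * Q + 1) * n ^ E) := by
          apply Nat.pow_le_pow_right (by norm_num)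
          exact Nat.mul_le_mul (by omega) h3
      _ = 2 ^ n ^ (2 * c * Q + 1 + E) := by rw [← pow_add]
  obtain ⟨A₁, hA₁, hA₁c, hS⟩ := exists_subset_forall (fun (t : T) => SignHom (g t.1 t.2)) 9
    (fun _ _ _ hAB hB => hB.mono hAB) (fun t => exists_signHom (g t.1 t.2)) univ _ A hsize
  obtain ⟨A₂, hA₂, hA₂c, hL⟩ := exists_subset_forall (fun (t : T) => Lacunary K (g t.1 t.2)) C₁
    (fun _ _ _ hAB hB => hB.mono hAB) (fun t => hC₁ (g t.1 t.2)) univ _ A₁ hA₁c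
  obtain ⟨A₃, hA₃, hA₃c, hG⟩ := exists_geometricAround K hK3 (fun (t : T) => g t.1 t.2) A₂
    (fun t => hL t (mem_univ t)) (fun t => (hS t (mem_univ t)).mono hA₂) ((n + 1) ^ c)
    (Nat.lt_of_succ_le hA₂c)
  choose ctr hctr using hG
  set F : Fin M → Option (Fin r) → ι → ℝ := fun j =>
    termSize (g j) (fun a => ctr (j, a)) with hF
  obtain ⟨B, hBA, hBc, hP⟩ := exists_subset_forall (fun (u : U × Bool) =>
      if u.2 then PairHom (fun v => ((r : ℝ) + 1) * F u.1.1 u.1.2.1 v) (F u.1.1 u.1.2.2)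
      else PairHom (F u.1.1 u.1.2.1) (fun v => ((r : ℝ) + 1) * F u.1.1 u.1.2.2 v)) 3
    (by
      intro u A B hAB hB
      split_ifs at hB ⊢
      exacts [hB.mono hAB, hB.mono hAB])
    (by
      intro u n A hA
      split_ifs
      exacts [exists_pairHom _ _ n A hA, exists_pairHom _ _ n A hA])
    univ (n + 1) A₃ hA₃c
  have hne : B.Nonempty := card_pos.1 (by omega)
  refine ⟨B.erase (B.min' hne),
    (erase_subset _ _).trans (hBA.trans (hA₃.trans (hA₂.trans hA₁))), ?_, fun j => ?_⟩
  · rw [card_erase_of_mem (B.min'_mem hne)]; omega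
  refine tupleSignHom_of_geometricAround (g j) (fun a => ctr (j, a)) (K := (K : ℝ) - 2) ?_
    (fun a => (hctr (j, a)).mono hBA) (fun t t' => ?_) (fun t t' => ?_) (B.min'_mem hne)
    (fun v hv => B.min'_le v hv) (by omega)
  · rw [hKdef]; push_cast; linarith
  · simpa using hP ((j, t, t'), true) (mem_univ _)
  · simpa using hP ((j, t, t'), false) (mem_univ _)

/-! ### From semi-linear hypergraphs to sums of one-point functions. -/

/-- A polynomial of degree at most one in `r` points is a sum of functions of the single points. -/
theorem exists_eval_eq_sum_of_totalDegree_le_one {r d : ℕ} (hr : 0 < r)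
    (f : MvPolynomial (Fin r × Fin d) ℝ) (hf : f.totalDegree ≤ 1) :
    ∃ G : Fin r → (Fin d → ℝ) → ℝ, ∀ x : Fin r → Fin d → ℝ,
      MvPolynomial.eval (fun ab => x ab.1 ab.2) f = ∑ a, G a (x a) := by
  classical
  -- A monomial of degree at most one involves at most one variable, hence at most one point; the
  -- constant monomial goes to point `0`, which uses `0 < r`.
  have hsupp : ∀ s : (Fin r × Fin d) →₀ ℕ, ∃ a : Fin r, s ∈ f.support → ∀ i ∈ s.support, i.1 = a := by
    intro s
    rcases s.support.eq_empty_or_nonempty with h | ⟨i, hi⟩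
    · exact ⟨⟨0, hr⟩, by simp [h]⟩
    · refine ⟨i.1, fun hs j hj => ?_⟩
      have h1 : s.sum (fun _ e => e) ≤ 1 := (MvPolynomial.le_totalDegree hs).trans hf
      have h2 : #s.support ≤ s.sum (fun _ e => e) := by
        rw [card_eq_sum_ones]
        exact sum_le_sum fun i hi => Nat.one_le_iff_ne_zero.2 (Finsupp.mem_support_iff.1 hi)
      rw [card_le_one.1 (h2.trans h1) j hj i hi]
  choose pt hpt using hsupp
  refine ⟨fun a y => ∑ s ∈ f.support with pt s = a,
    f.coeff s * ∏ i ∈ s.support, y i.2 ^ s i, fun x => ?_⟩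
  rw [MvPolynomial.eval_eq, ← sum_fiberwise f.support pt]
  refine sum_congr rfl fun a _ => sum_congr rfl fun s hs => ?_
  obtain ⟨hsf, hsa⟩ := mem_filter.1 hs
  congr 1
  exact prod_congr rfl fun i hi => by rw [hpt s hsf i hi, hsa]

/-- On a set `A` of vertices along which the enumeration of a semi-linear hypergraph is monotone,
adjacency is determined by the signs of finitely many sums `∑ a, g j a (s a)`. -/
theorem exists_adjacency_of_isSemiAlgebraic {α : Type*} {H : Hypergraph α} {r d m N : ℕ}
    (hr : 0 < r) (hH : H.IsSemiAlgebraic r d 1 m) (e : Fin N → α) (he : Function.Injective e)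
    (heH : ∀ k, e k ∈ H.vertexSet) :
    ∃ pos : Fin N → ℝ, ∀ A : Finset (Fin N), SignHom pos A →
      ∃ g : Fin m → Fin r → Fin N → ℝ, ∀ B ⊆ A, (∀ j, TupleSignHom (g j) B) →
        ∃ Q : Prop, ∀ s : Fin r → Fin N, StrictMono s → (∀ a, s a ∈ B) →
          (Set.range (fun a => e (s a)) ∈ H.edgeSet ↔ Q) := by
  obtain ⟨-, N', v, pt, f, Φ, hv, hrange, hdeg, hadj⟩ := hH
  have hidx : ∀ k, ∃ l, v l = e k := fun k => by
    have := heH k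
    rw [← hrange] at this
    exact this
  choose idx hidx using hidx
  have hinj : Function.Injective idx := fun k l hkl => he (by rw [← hidx, ← hidx, hkl])
  choose G hG using fun j => exists_eval_eq_sum_of_totalDegree_le_one hr (f j) (hdeg j)
  refine ⟨fun k => ((idx k : ℕ) : ℝ), fun A hA => ?_⟩
  -- Along `A` the enumeration of `H` agrees with the given order or reverses it, so increasing
  -- tuples become increasing after the identity or the reversal of positions.
  obtain ⟨π, hπ⟩ : ∃ π : Equiv.Perm (Fin r), ∀ s : Fin r → Fin N, StrictMono s → (∀ a, s a ∈ A) →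
      StrictMono (fun a => idx (s (π a))) := by
    obtain ⟨σ, hσ⟩ := hA
    by_cases h : σ = -1
    · refine ⟨Fin.revPerm, fun s hs hsA a b hab => ?_⟩
      have h1 := hσ _ (hsA _) _ (hsA _) (hs (Fin.rev_lt_rev.2 hab))
      rw [h, sign_eq_neg_one_iff, sub_neg] at h1
      simpa using h1
    · refine ⟨1, fun s hs hsA a b hab => ?_⟩
      have h1 := hσ _ (hsA _) _ (hsA _) (hs hab)
      by_contra hlt
      have h2 : idx (s b) < idx (s a) := lt_of_le_of_ne (not_lt.1 hlt) fun hh =>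
        (hs hab).ne (hinj hh).symm
      refine h ?_
      rw [← h1, sign_eq_neg_one_iff, sub_neg]
      simpa using h2
  refine ⟨fun j a k => G j (π.symm a) (pt (idx k)), fun B hBA hB => ?_⟩
  choose σ hσ using hB
  refine ⟨Φ σ, fun s hs hsB => ?_⟩
  have hsA : ∀ a, s a ∈ A := fun a => hBA (hsB a)
  have h1 := hadj _ (hπ s hs hsA)
  have h2 : Set.range (fun a => v (idx (s (π a)))) = Set.range (fun a => e (s a)) := by
    simp only [hidx]
    exact π.surjective.range_comp (fun a => e (s a))
  rw [h2] at h1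
  rw [h1]
  have h3 : (fun j => SignType.sign (MvPolynomial.eval
      (fun ab : Fin r × Fin d => pt (idx (s (π ab.1))) ab.2) (f j))) = σ := by
    funext j
    rw [hG j (fun a => pt (idx (s (π a)))), ← hσ j s hs hsB,
      ← Equiv.sum_comp π (fun a => G j (π.symm a) (pt (idx (s a))))]
    simp
  rw [h3]

/-! ### Monochromatic cliques. -/

open Hypergraph

theorem exists_clique_of_homogeneous {α : Type*} {r p N : ℕ} (hp : 0 < p) {X : Set α}
    (χ : (completeUniformOn X r).EdgeMulticoloring p) (e : Fin N → α) (he : Function.Injective e)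
    (heX : ∀ k, e k ∈ X) (B : Finset (Fin N))
    (hB : ∀ i, ∃ Q : Prop, ∀ s : Fin r → Fin N, StrictMono s → (∀ a, s a ∈ B) →
      (Set.range (fun a => e (s a)) ∈ (χ.colorClass i).edgeSet ↔ Q)) :
    ∃ i, (χ.colorClass i).IsUniformClique r (e '' B) := by
  classical
  have hsub : e '' B ⊆ X := by
    rintro _ ⟨k, -, rfl⟩
    exact heX k
  have hmem : ∀ E ⊆ e '' B, E.encard = r → ∃ s : Fin r → Fin N, StrictMono s ∧ (∀ a, s a ∈ B) ∧
      Set.range (fun a => e (s a)) = E := by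
    intro E hE hcard
    obtain ⟨S, hSB, rfl⟩ := Set.subset_image_iff.1 hE
    rw [he.encard_image] at hcard
    have hfin : S.Finite := S.toFinite
    lift S to Finset (Fin N) using hfin
    rw [Set.encard_coe_eq_coe_finsetCard] at hcard
    have hS : #S = r := by exact_mod_cast hcard
    refine ⟨S.orderEmbOfFin hS, (S.orderEmbOfFin hS).strictMono,
      fun a => hSB (S.orderEmbOfFin_mem hS a), ?_⟩
    rw [← S.range_orderEmbOfFin hS, ← Set.range_comp]
    rfl
  by_cases hall : ∃ E ⊆ e '' B, E.encard = r
  · obtain ⟨E, hE, hEr⟩ := hall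
    obtain ⟨i, hi⟩ := χ.colors_nonempty ⟨E, hE.trans hsub, hEr⟩
    refine ⟨i, hsub, fun E' hE' hEr' => ?_⟩
    obtain ⟨Q, hQ⟩ := hB i
    obtain ⟨s, hs, hsB, rfl⟩ := hmem E hE hEr
    obtain ⟨s', hs', hsB', rfl⟩ := hmem E' hE' hEr'
    exact (hQ s' hs' hsB').2 ((hQ s hs hsB).1 ⟨_, hi⟩)
  · push Not at hall
    exact ⟨⟨0, hp⟩, hsub, fun E hE hEr => absurd hEr (hall E hE)⟩

theorem exists_clique (r m p : ℕ) (hr : 0 < r) (hp : 0 < p) : ∃ C : ℕ, 0 < C ∧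
    ∀ (d : ℕ) {α : Type*} (N : ℕ) (X : Set α), X.encard = N →
      ∀ χ : (completeUniformOn X r).EdgeMulticoloring p,
        (∀ i, (χ.colorClass i).IsSemiAlgebraic r d 1 m) →
        ∀ n : ℕ, 2 ≤ n → 2 ^ n ^ C ≤ N →
        ∃ (i : Fin p) (S : Set α), (χ.colorClass i).IsUniformClique r S ∧ n ≤ S.ncard := by
  classical
  obtain ⟨C, hC⟩ := exists_tupleSignHom r (p * m)
  -- The extra `9 ^ p` pays for making all `p` vertex enumerations monotone on a common set, as `9 ^
  -- p ≤ n ^ 9 ^ p`.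
  refine ⟨C + 9 ^ p, by positivity, fun d α N X hX χ hχ n hn hN => ?_⟩
  have hfin : X.Finite := Set.finite_of_encard_eq_coe hX
  have hcard : Nat.card X = N := by
    rw [Nat.card_coe_set_eq, Set.ncard, hX, ENat.toNat_natCast]
  have : Finite X := hfin
  set e : Fin N → α := fun k => ((Finite.equivFinOfCardEq hcard).symm k : α)
  have he : Function.Injective e := Subtype.val_injective.comp (Equiv.injective _)
  have heX : ∀ k, e k ∈ X := fun k => Subtype.coe_prop _
  choose pos hpos using fun i => exists_adjacency_of_isSemiAlgebraic hr (hχ i) e he heX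
  obtain ⟨A, -, hAc, hA⟩ := exists_subset_forall (fun i => SignHom (pos i)) 9
    (fun _ _ _ hAB hB => hB.mono hAB) (fun i => exists_signHom (pos i)) univ (2 ^ n ^ C)
    (univ : Finset (Fin N)) (by
      rw [card_univ, card_univ, Fintype.card_fin, Fintype.card_fin, ← pow_mul]
      refine le_trans (Nat.pow_le_pow_right (by norm_num) ?_) hN
      rw [pow_add]
      exact Nat.mul_le_mul le_rfl (Nat.lt_pow_self hn).le)
  choose g hg using fun i => hpos i A (hA i (mem_univ i))
  obtain ⟨B, hBA, hBc, hB⟩ := hC (fun l => g (finProdFinEquiv.symm l).1 (finProdFinEquiv.symm l).2)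
    n A hn hAc
  obtain ⟨i, hi⟩ := exists_clique_of_homogeneous hp χ e he heX B (fun i =>
    hg i B hBA fun j => by simpa using hB (finProdFinEquiv (i, j)))
  refine ⟨i, e '' B, hi, ?_⟩
  rwa [Set.ncard_image_of_injective _ he, Set.ncard_coe_finset]

/-- This covers the small `N`, where the asserted size is at most `2`: pigeonhole for `r = 1`, a
single edge for `r = 2`, and no edges to check for `r ≥ 3`. -/
theorem exists_clique_two {α : Type*} {r p N : ℕ} (hr : 0 < r) (hp : 0 < p) {X : Set α}
    (hX : X.encard = N) (hN : 2 ≤ N) (hpN : r = 1 → p < N)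
    (χ : (completeUniformOn X r).EdgeMulticoloring p) :
    ∃ (i : Fin p) (S : Set α), (χ.colorClass i).IsUniformClique r S ∧ S.ncard = 2 := by
  classical
  have hfin : X.Finite := Set.finite_of_encard_eq_coe hX
  lift X to Finset α using hfin
  rw [Set.encard_coe_eq_coe_finsetCard] at hX
  have hX' : #X = N := by exact_mod_cast hX
  by_cases h1 : r = 1
  · subst h1
    have hcol : ∀ x ∈ X, ∃ i, {x} ∈ (χ.colorClass i).edgeSet := by
      intro x hx
      have hmem : ({x} : Set α) ∈ (completeUniformOn (X : Set α) 1).edgeSet :=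
        ⟨by simpa using hx, by simp⟩
      obtain ⟨i, hi⟩ := χ.colors_nonempty ⟨{x}, hmem⟩
      exact ⟨i, hmem, hi⟩
    have : Nonempty (Fin p) := ⟨⟨0, hp⟩⟩
    choose! f hf using hcol
    obtain ⟨x, hx, y, hy, hne, hxy⟩ := exists_ne_map_eq_of_card_lt_of_maps_to
      (s := X) (t := (univ : Finset (Fin p))) (by simpa [hX'] using hpN rfl) (f := f)
      (fun _ _ => mem_univ _)
    refine ⟨f x, {x, y}, ⟨?_, ?_⟩, Set.ncard_pair hne⟩
    · exact Set.insert_subset hx (Set.singleton_subset_iff.2 hy)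
    · intro E hE hEc
      obtain ⟨z, rfl⟩ := Set.encard_eq_one.1 (by simpa using hEc)
      rcases hE rfl with rfl | h
      · exact hf z hx
      · rw [Set.mem_singleton_iff.1 h, hxy]; exact hf y hy
  · obtain ⟨x, hx, y, hy, hne⟩ := one_lt_card.1 (by omega : 1 < #X)
    have hsub : ({x, y} : Set α) ⊆ X := Set.insert_subset hx (Set.singleton_subset_iff.2 hy)
    by_cases h2 : r = 2
    · subst h2
      have hmem : ({x, y} : Set α) ∈ (completeUniformOn (X : Set α) 2).edgeSet :=
        ⟨hsub, by simpa using Set.encard_pair hne⟩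
      obtain ⟨i, hi⟩ := χ.colors_nonempty ⟨_, hmem⟩
      refine ⟨i, {x, y}, ⟨hsub, fun E hE hEc => ?_⟩, Set.ncard_pair hne⟩
      have hEq : E = {x, y} := ((Set.toFinite _).subset hE).eq_of_subset_of_encard_le hE
        (by rw [Set.encard_pair hne, hEc]; rfl)
      rw [hEq]
      exact ⟨hmem, hi⟩
    · refine ⟨⟨0, hp⟩, {x, y}, ⟨hsub, fun E hE hEc => ?_⟩, Set.ncard_pair hne⟩
      have h3 := Set.encard_le_encard hE
      rw [Set.encard_pair hne, hEc] at h3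
      have h4 : r ≤ 2 := by exact_mod_cast h3
      omega

end SemilinearRamsey

theorem theorem1p5 (r m p : ℕ) (hr : 0 < r) (hm : 0 < m) (hp : 0 < p) :
    ∃ c : ℝ, 0 < c ∧
      ∀ d : ℕ, 0 < d →
      ∀ (α : Type*) (N : ℕ) (X : Set α), X.encard = N →
      -- for `r = 1`, a colouring with `p ≥ N` colours may give every vertex a colour of its own
      (r = 1 → p < N) →
      ∀ χ : (Hypergraph.completeUniformOn X r).EdgeMulticoloring p,
        (∀ i, (χ.colorClass i).IsSemiAlgebraic r d 1 m) →
        ∃ (i : Fin p) (C : Set α),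
          (χ.colorClass i).IsUniformClique r C ∧ Real.log N ^ c ≤ C.ncard := by
  obtain ⟨C, hC0, hC⟩ := SemilinearRamsey.exists_clique r m p hr hp
  have hC0' : (0 : ℝ) < C := by exact_mod_cast hC0
  -- The factor `1 / 2` absorbs rounding: with `z = (log N) ^ (1 / C)`, `√z ≤ 2` if `z ≤ 4`, and `√z
  -- ≤ ⌊z⌋₊` otherwise.
  refine ⟨1 / (C : ℝ) * (1 / 2), by positivity, fun d _ α N X hX hpN χ hχ => ?_⟩
  rcases Nat.lt_or_ge N 2 with hN | hN
  · refine ⟨⟨0, hp⟩, ∅, ⟨Set.empty_subset _, fun E hE hEr => ?_⟩, ?_⟩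
    · rw [Set.subset_empty_iff.1 hE, Set.encard_empty] at hEr
      exact absurd (by exact_mod_cast hEr : 0 = r) hr.ne
    · have : Real.log N = 0 := by interval_cases N <;> simp
      rw [this, Real.zero_rpow (by positivity)]
      positivity
  have hlog : 0 ≤ Real.log N := Real.log_natCast_nonneg N
  rw [Real.rpow_mul hlog, ← Real.sqrt_eq_rpow]
  set z := Real.log N ^ (1 / (C : ℝ)) with hz
  have hz0 : 0 ≤ z := Real.rpow_nonneg hlog _
  rcases le_or_gt z 4 with h4 | h4
  · obtain ⟨i, S, hS, hS2⟩ := SemilinearRamsey.exists_clique_two hr hp hX hN hpN χ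
    refine ⟨i, S, hS, ?_⟩
    rw [hS2, Real.sqrt_le_left (by norm_num)]
    norm_num
    exact h4
  · have hfl : z < ⌊z⌋₊ + 1 := Nat.lt_floor_add_one z
    have hn : 2 ≤ ⌊z⌋₊ := Nat.le_floor (by norm_num; linarith)
    have hpow : 2 ^ ⌊z⌋₊ ^ C ≤ N := by
      have h1 : (⌊z⌋₊ : ℝ) ^ C ≤ Real.log N := by
        calc (⌊z⌋₊ : ℝ) ^ C ≤ z ^ C := by gcongr; exact Nat.floor_le hz0
          _ = Real.log N := by rw [hz, one_div, Real.rpow_inv_natCast_pow hlog hC0.ne']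
      have h2 : Real.log ((2 : ℝ) ^ ⌊z⌋₊ ^ C) ≤ Real.log N := by
        rw [Real.log_pow]
        refine le_trans (mul_le_of_le_one_right (by positivity) ?_) (by exact_mod_cast h1)
        linarith [Real.log_two_lt_d9]
      have h3 := (Real.log_le_log_iff (by positivity) (by positivity)).1 h2
      exact_mod_cast h3
    obtain ⟨i, S, hS, hSn⟩ := hC d N X hX χ hχ _ hn hpow
    refine ⟨i, S, hS, le_trans ?_ (Nat.cast_le.2 hSn)⟩
    rw [Real.sqrt_le_left (by positivity)]
    nlinarith
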